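/- Let $K \ge 1$ and $\alpha > 0$. For each $k \in \{1,\dots,K\}$ let $\lambda_k, P_k, B_k > 0$, and let the base stations (BSs) of tier $k$ form a homogeneous Poisson point process $\Phi_k$ of density $\lambda_k$ on $\mathbb{R}^2$; the processes $\Phi_1,\dots,\Phi_K$ are independent. To the BSs $x \in \Phi_k$ attach shadowing gains $\mathcal{X}_{kx} > 0$ that are, given the locations of all BSs, independent over all BSs of all tiers and, within tier $k$, distributed like a random variable $\mathcal{X}_k > 0$, whose distribution is arbitrary subject to $\mathbb{E}[\mathcal{X}_k^{2/\alpha}] < \infty$. A typical user is located at the origin. The candidate serving BS of tier $k$ is $x_k^* = \arg\max_{x \in \Phi_k} P_k \mathcal{X}_{kx} \|x\|^{-\alpha}$, and the user connects to the BS $x^*$ which maximizes the biased long-term received power $B_k P_k \mathcal{X}_{k x_k^*} \|x_k^*\|^{-\alpha}$ among the candidates $x_1^*,\dots,x_K^*$. Then almost surely all these maximizers exist and are unique, and, for every $k$, the probability $\mathcal{P}_k = \mathbb{P}(x^* \in \Phi_k)$ that the user connects to tier $k$ is $$\mathcal{P}_k = \frac{\lambda_k\, \mathbb{E}[\mathcal{X}_k^{2/\alpha}]\,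 B_k^{2/\alpha} P_k^{2/\alpha}}{\sum_{j=1}^{K} \lambda_j\, \mathbb{E}[\mathcal{X}_j^{2/\alpha}]\, B_j^{2/\alpha} P_j^{2/\alpha}}.$$ -/

import Mathlib

open MeasureTheory ProbabilityTheory

/-- The Euclidean plane in which base stations and users are located. -/
abbrev Plane : Type := EuclideanSpace ℝ (Fin 2)

section PointProcess

variable {Ω : Type*}

/-- The number of points, counted with multiplicity, that the random sequence of points
`X 0, X 1, …` has in the set `A`. -/
noncomputable def pointCount (X : ℕ → Ω → Plane) (A : Set Plane) (ω : Ω) : ℕ∞ :=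
  {i : ℕ | X i ω ∈ A}.encard

/-- The points `X 0, X 1, …` enumerate a homogeneous Poisson point process of density `dens` on the
plane: the numbers of points in finitely many pairwise disjoint bounded Borel sets `A j` are
independent Poisson variables with means `dens * |A j|`.  (A process of positive density has
almost surely infinitely many points, so it can be enumerated by `ℕ`.) -/
structure IsHomogeneousPPP [MeasurableSpace Ω] (X : ℕ → Ω → Plane) (dens : ℝ) (μ : Measure Ω) :
    Prop where
  measurable : ∀ i, Measurable (X i)
  count_law : ∀ (m : ℕ) (A : Fin m → Set Plane) (n : Fin m → ℕ),
    (∀ j, MeasurableSet (A j)) → (∀ j, Bornology.IsBounded (A j)) →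
    (∀ i j, i ≠ j → Disjoint (A i) (A j)) →
    μ.real {ω | ∀ j, pointCount X (A j) ω = (n j : ℕ∞)} =
      ∏ j, Real.exp (-(dens * volume.real (A j))) * (dens * volume.real (A j)) ^ (n j) /
        (n j).factorial

/-- The point process enumerated by `X`, as a random family of counts of all Borel sets. -/
noncomputable def countingProcess (X : ℕ → Ω → Plane) (ω : Ω) :
    {A : Set Plane // MeasurableSet A} → ℕ∞ :=
  fun A => pointCount X A.1 ω

end PointProcess

section CellSelection

variable {Ω : Type*} {K : ℕ}

/-- Long-term power `P_k 𝒳 ‖x‖^(-α)` received at the origin from the `i`-th base station of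
tier `k`, which is located at `X k i` and has the shadowing gain `χ k i`. -/
noncomputable def longTermPower (α : ℝ) (P : Fin K → ℝ) (X : Fin K → ℕ → Ω → Plane)
    (χ : Fin K → ℕ → Ω → ℝ) (k : Fin K) (i : ℕ) (ω : Ω) : ℝ :=
  P k * χ k i ω * ‖X k i ω‖ ^ (-α)

/-- The `i`-th base station of tier `k` is a candidate serving base station: it maximizes the
long-term received power over its own tier. -/
def IsCandidate (α : ℝ) (P : Fin K → ℝ) (X : Fin K → ℕ → Ω → Plane)
    (χ : Fin K → ℕ → Ω → ℝ) (k : Fin K) (i : ℕ) (ω : Ω) : Prop :=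
  ∀ i', longTermPower α P X χ k i' ω ≤ longTermPower α P X χ k i ω

/-- The `i`-th base station of tier `k` is the serving base station: it is a candidate and
maximizes the biased received power over the candidates of all tiers. -/
def IsServing (α : ℝ) (P B : Fin K → ℝ) (X : Fin K → ℕ → Ω → Plane)
    (χ : Fin K → ℕ → Ω → ℝ) (k : Fin K) (i : ℕ) (ω : Ω) : Prop :=
  IsCandidate α P X χ k i ω ∧
    ∀ k' i', IsCandidate α P X χ k' i' ω →
      B k' * longTermPower α P X χ k' i' ω ≤ B k * longTermPower α P X χ k i ω

open Classical in
/-- The selection indicator `s(k)`: it is `1` if the serving base station belongs to tier `k`, and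
`0` otherwise. -/
noncomputable def selectionIndicator (α : ℝ) (P B : Fin K → ℝ) (X : Fin K → ℕ → Ω → Plane)
    (χ : Fin K → ℕ → Ω → ℝ) (k : Fin K) (ω : Ω) : ℕ :=
  if ∃ i, IsServing α P B X χ k i ω then 1 else 0

end CellSelection

/-! Give a station of tier `k` at `x` with gain `t` the path loss `T = (B_k P_k t ‖x‖^(-α))^(-2/α)`.
A negative power reverses order, so the strongest biased signal is the smallest `T`. For fixed `t`,
`T` is proportional to `‖x‖²`, so `a < T ≤ c` describes an annulus of area proportional to `c - a`.
Averaging over the gain, the path losses of tier `k` form a homogeneous Poisson process on the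
half-line of rate `m_k = π λ_k (B_k P_k)^(2/α) E[𝒳_k^(2/α)]`. The first point of independent Poisson
processes belongs to process `k` with probability `m_k / ∑ m_j`, and the factor `π` cancels.

The Poisson property is carried by Laplace transforms. `IsHomogeneousPPP.lintegral_expNeg_tsum`
computes the Laplace functional from the count law, and `lintegral_expNeg_tsum_marked` adds marks
and several tiers. `isPoissonFamily_pathLoss` keeps only the transforms of counts in one interval
per tier. These suffice: `ae_finite_and_injective` derives local finiteness and the absence of ties,
hence existence and uniqueness of the maximizers, and `measureReal_first` derives the probabilities
from void probabilities on a fine grid. -/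

open scoped ENNReal NNReal

/-! ### Laplace transforms with values in `[0, ∞]` -/

/-- The function `x ↦ exp (-x)` on `[0, ∞]`. -/
noncomputable def expNeg (x : ℝ≥0∞) : ℝ≥0∞ := EReal.exp (-(x : EReal))

@[simp] lemma expNeg_zero : expNeg 0 = 1 := by simp [expNeg]

@[simp] lemma expNeg_top : expNeg ∞ = 0 := by simp [expNeg]

lemma expNeg_ofReal {x : ℝ} (hx : 0 ≤ x) :
    expNeg (ENNReal.ofReal x) = ENNReal.ofReal (Real.exp (-x)) := by
  rw [expNeg, EReal.coe_ennreal_ofReal, max_eq_left hx, ← EReal.coe_neg, EReal.exp_coe]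

lemma expNeg_add (x y : ℝ≥0∞) : expNeg (x + y) = expNeg x * expNeg y := by
  rw [expNeg, expNeg, expNeg, ← EReal.exp_add, EReal.coe_ennreal_add,
    EReal.neg_add (by simp) (by simp), sub_eq_add_neg]

lemma expNeg_sum {ι : Type*} (s : Finset ι) (f : ι → ℝ≥0∞) :
    expNeg (∑ i ∈ s, f i) = ∏ i ∈ s, expNeg (f i) := by
  classical
  induction s using Finset.induction_on with
  | empty => simp
  | insert a s ha ih => rw [Finset.sum_insert ha, Finset.prod_insert ha, expNeg_add, ih]

lemma continuous_expNeg : Continuous expNeg :=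
  ENNReal.continuous_exp.comp (continuous_neg.comp continuous_coe_ennreal_ereal)

lemma measurable_expNeg : Measurable expNeg := continuous_expNeg.measurable

lemma expNeg_le_one (x : ℝ≥0∞) : expNeg x ≤ 1 := by
  simp [expNeg, EReal.coe_ennreal_nonneg]

lemma expNeg_mul_natCast (c : ℝ≥0∞) (n : ℕ) : expNeg (c * n) = expNeg c ^ n := by
  induction n with
  | zero => simp
  | succ n ih => rw [Nat.cast_succ, mul_add, expNeg_add, ih, mul_one, pow_succ]

lemma tendsto_prod_expNeg {ι : Type*} (f : ι → ℝ≥0∞) :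
    Filter.Tendsto (fun s : Finset ι => ∏ i ∈ s, expNeg (f i)) Filter.atTop
      (nhds (expNeg (∑' i, f i))) := by
  simp_rw [← expNeg_sum]
  exact (continuous_expNeg.tendsto _).comp ENNReal.summable.hasSum

/-- Used to write the mark average of `expNeg ∘ h` as `expNeg ∘ g`, which reduces a marked process
to an unmarked one. Where `f` vanishes, `g` is `∞`. -/
lemma exists_expNeg_eq {E : Type*} [MeasurableSpace E] {f : E → ℝ≥0∞} (hf : Measurable f)
    (hf1 : ∀ x, f x ≤ 1) : ∃ g : E → ℝ≥0∞, Measurable g ∧ ∀ x, expNeg (g x) = f x := by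
  refine ⟨fun x => (-(ENNReal.log (f x))).toENNReal, ?_, fun x => ?_⟩
  · exact (hf.ennreal_log.neg).ereal_toENNReal
  · rw [expNeg, EReal.coe_toENNReal, neg_neg, ENNReal.exp_log]
    simpa using hf1 x

/-- The Poisson generating function at `z = expNeg c`. The case `c = ∞`, `z = 0` is included and
later gives void probabilities. -/
lemma lintegral_expNeg_poissonMeasure (r : ℝ≥0) (c : ℝ≥0∞) :
    ∫⁻ n : ℕ, expNeg (c * n) ∂(poissonMeasure r) = expNeg (r * (1 - expNeg c)) := by
  obtain ⟨z, hz⟩ : ∃ z : ℝ≥0, expNeg c = z :=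
    ⟨(expNeg c).toNNReal, (ENNReal.coe_toNNReal
      ((expNeg_le_one c).trans_lt ENNReal.one_lt_top).ne).symm⟩
  have hz1 : z ≤ 1 := by exact_mod_cast hz ▸ expNeg_le_one c
  have hsum := (NormedSpace.expSeries_div_hasSum_exp ((r : ℝ) * z)).mul_left (Real.exp (-r))
  have hterm : ∀ n : ℕ, ENNReal.ofReal (Real.exp (-r) * (r : ℝ) ^ n / n.factorial) * expNeg (c * n)
      = ENNReal.ofReal (Real.exp (-r) * (((r : ℝ) * z) ^ n / n.factorial)) := by
    intro n
    rw [expNeg_mul_natCast, hz, ← ENNReal.coe_pow, ← ENNReal.ofReal_coe_nnreal,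
      ← ENNReal.ofReal_mul (by positivity), NNReal.coe_pow, mul_pow]
    congr 1
    ring
  have hrhs : (r : ℝ≥0∞) * (1 - expNeg c) = ENNReal.ofReal ((r : ℝ) * (1 - (z : ℝ))) := by
    rw [hz, ENNReal.ofReal_mul r.coe_nonneg, ENNReal.ofReal_sub _ z.coe_nonneg]
    simp
  rw [hrhs, expNeg_ofReal (mul_nonneg r.coe_nonneg (sub_nonneg.2 (by exact_mod_cast hz1))), poissonMeasure,
    lintegral_sum_measure]
  simp_rw [lintegral_smul_measure, lintegral_dirac, smul_eq_mul, hterm]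
  rw [← ENNReal.ofReal_tsum_of_nonneg (fun n => by positivity) hsum.summable, hsum.tsum_eq,
    ← Real.exp_eq_exp_ℝ, ← Real.exp_add]
  congr 2
  ring

/-! ### Joint law of the counts -/

lemma pointCount_eq_tsum {Ω : Type*} (X : ℕ → Ω → Plane) (A : Set Plane) (ω : Ω) :
    ((pointCount X A ω : ℕ∞) : ℝ≥0∞) = ∑' i, A.indicator 1 (X i ω) := by
  rw [pointCount, ← ENNReal.tsum_set_one, tsum_subtype {i | X i ω ∈ A} fun _ => (1 : ℝ≥0∞)]
  rfl

section Counts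

variable {Ω : Type*} [MeasurableSpace Ω]

lemma measurable_pointCount {X : ℕ → Ω → Plane} (hX : ∀ i, Measurable (X i)) {A : Set Plane}
    (hA : MeasurableSet A) : Measurable (pointCount X A) := by
  have h : Measurable fun ω => ((pointCount X A ω : ℕ∞) : ℝ≥0∞) := by
    simp_rw [pointCount_eq_tsum]
    exact Measurable.tsum fun i => (measurable_one.indicator hA).comp (hX i)
  refine measurable_to_countable' fun n => ?_
  have : pointCount X A ⁻¹' {n} = (fun ω => ((pointCount X A ω : ℕ∞) : ℝ≥0∞)) ⁻¹' {(n : ℝ≥0∞)} := by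
    ext ω; simp
  rw [this]
  exact h (measurableSet_singleton _)

lemma measurable_countingProcess {X : ℕ → Ω → Plane} (hX : ∀ i, Measurable (X i)) :
    Measurable (countingProcess X) :=
  measurable_pi_lambda _ fun A => measurable_pointCount hX A.2

variable {μ : Measure Ω} [IsProbabilityMeasure μ]

lemma IsHomogeneousPPP.map_pointCount {X : ℕ → Ω → Plane} {dens : ℝ}
    (hX : IsHomogeneousPPP X dens μ) (hd : 0 ≤ dens) {m : ℕ} {A : Fin m → Set Plane}
    (hA : ∀ j, MeasurableSet (A j)) (hAb : ∀ j, Bornology.IsBounded (A j))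
    (hAd : ∀ i j, i ≠ j → Disjoint (A i) (A j)) :
    μ.map (fun ω j => pointCount X (A j) ω) =
      (Measure.pi fun j => poissonMeasure (dens * volume.real (A j)).toNNReal).map
        (fun n j => (n j : ℕ∞)) := by
  have hm : Measurable fun ω j => pointCount X (A j) ω :=
    measurable_pi_lambda _ fun j => measurable_pointCount hX.measurable (hA j)
  have hc : Measurable fun (n : Fin m → ℕ) j => (n j : ℕ∞) := .of_discrete
  have : IsProbabilityMeasure (μ.map fun ω j => pointCount X (A j) ω) :=
    Measure.isProbabilityMeasure_map hm.aemeasurable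
  have : IsProbabilityMeasure ((Measure.pi fun j =>
      poissonMeasure (dens * volume.real (A j)).toNNReal).map fun n j => (n j : ℕ∞)) :=
    Measure.isProbabilityMeasure_map hc.aemeasurable
  have key : ∀ n : Fin m → ℕ, μ {ω | ∀ j, pointCount X (A j) ω = (n j : ℕ∞)} =
      Measure.pi (fun j => poissonMeasure (dens * volume.real (A j)).toNNReal) {n} := by
    intro n
    rw [Measure.pi_singleton, ← ofReal_measureReal, hX.count_law m A n hA hAb hAd,
      ENNReal.ofReal_prod_of_nonneg fun j _ => by positivity]
    refine Finset.prod_congr rfl fun j _ => ?_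
    rw [poissonMeasure_singleton, Real.coe_toNNReal _ (by positivity)]
  symm
  -- The count law only speaks of finite counts, whereas counts live in `ℕ∞`. The finite vectors
  -- already carry total mass one, so an inequality between the two probability measures suffices.
  refine Measure.eq_of_le_of_measure_univ_eq (Measure.le_iff.2 fun S hS => ?_) (by simp)
  rw [Measure.map_apply hc hS, Measure.map_apply hm hS]
  calc _ = ∑' n : (fun (n : Fin m → ℕ) j => (n j : ℕ∞)) ⁻¹' S,
        Measure.pi (fun j => poissonMeasure (dens * volume.real (A j)).toNNReal) {n.1} := by
        rw [← measure_biUnion (Set.to_countable _) ?_ (fun _ _ => .of_discrete)]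
        · congr 1
          ext n
          simp
        · intro a _ b _ hab
          simpa using hab
    _ = ∑' n : (fun (n : Fin m → ℕ) j => (n j : ℕ∞)) ⁻¹' S,
        μ {ω | ∀ j, pointCount X (A j) ω = (n.1 j : ℕ∞)} := by simp_rw [key]
    _ = μ (⋃ n ∈ (fun (n : Fin m → ℕ) j => (n j : ℕ∞)) ⁻¹' S,
        {ω | ∀ j, pointCount X (A j) ω = (n j : ℕ∞)}) := by
        rw [measure_biUnion (Set.to_countable _)]
        · intro a _ b _ hab
          refine Set.disjoint_left.2 fun ω ha hb => hab ?_
          ext j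
          exact_mod_cast (ha j).symm.trans (hb j)
        · intro n _
          rw [Set.ofPred_forall]
          exact .iInter fun j => measurable_pointCount hX.measurable (hA j) (.of_discrete (s := {_}))
    _ ≤ _ := by
        refine measure_mono (Set.iUnion₂_subset fun n hn ω hω => ?_)
        have : (fun j => pointCount X (A j) ω) = fun j => (n j : ℕ∞) := funext hω
        simpa [this] using hn

lemma IsHomogeneousPPP.lintegral_expNeg_sum_pointCount {X : ℕ → Ω → Plane} {dens : ℝ}
    (hX : IsHomogeneousPPP X dens μ) (hd : 0 ≤ dens) {m : ℕ} {A : Fin m → Set Plane}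
    (hA : ∀ j, MeasurableSet (A j)) (hAb : ∀ j, Bornology.IsBounded (A j))
    (hAd : ∀ i j, i ≠ j → Disjoint (A i) (A j)) (c : Fin m → ℝ≥0∞) :
    ∫⁻ ω, expNeg (∑ j, c j * (pointCount X (A j) ω : ℕ∞)) ∂μ =
      expNeg (ENNReal.ofReal dens * ∑ j, volume (A j) * (1 - expNeg (c j))) := by
  have hm : Measurable fun ω j => pointCount X (A j) ω :=
    measurable_pi_lambda _ fun j => measurable_pointCount hX.measurable (hA j)
  have hc : Measurable fun (n : Fin m → ℕ) j => (n j : ℕ∞) := .of_discrete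
  have hF : Measurable fun N : Fin m → ℕ∞ => expNeg (∑ j, c j * (N j : ℕ∞)) :=
    measurable_expNeg.comp (Finset.measurable_sum _ fun j _ =>
      ((Measurable.of_discrete (f := fun n : ℕ∞ => (n : ℝ≥0∞))).comp
        (measurable_pi_apply j)).const_mul _)
  rw [← lintegral_map (μ := μ) hF hm, hX.map_pointCount hd hA hAb hAd, lintegral_map hF hc]
  simp_rw [expNeg_sum, ENat.toENNReal_coe]
  rw [Finset.mul_sum, expNeg_sum, lintegral_prod_eq_prod_lintegral_of_indepFun Finset.univ
      (fun j (n : Fin m → ℕ) => expNeg (c j * n j))]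
  · refine Finset.prod_congr rfl fun j _ => ?_
    rw [(measurePreserving_eval (fun j => poissonMeasure (dens * volume.real (A j)).toNNReal)
      j).lintegral_comp (f := fun n : ℕ => expNeg (c j * n)) .of_discrete,
      lintegral_expNeg_poissonMeasure, ← mul_assoc]
    congr 2
    change ENNReal.ofReal _ = _
    rw [ENNReal.ofReal_mul hd, ofReal_measureReal (hAb j).measure_lt_top.ne]
  · exact iIndepFun_pi (X := fun j (n : ℕ) => expNeg (c j * n))
      fun j => Measurable.of_discrete.aemeasurable
  · intro j
    exact (Measurable.of_discrete (f := fun n : ℕ => expNeg (c j * n))).comp (measurable_pi_apply j)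

end Counts

/-! ### Laplace functional of a Poisson point process -/

lemma tsum_simpleFunc_apply {Ω : Type*} (X : ℕ → Ω → Plane) (φ : SimpleFunc Plane ℝ≥0∞) (ω : Ω) :
    ∑' i, φ (X i ω) = ∑ c ∈ φ.range, c * (pointCount X (φ ⁻¹' {c}) ω : ℕ∞) := by
  simp_rw [pointCount_eq_tsum, ← ENNReal.tsum_mul_left]
  rw [← Summable.tsum_finsetSum fun _ _ => ENNReal.summable]
  refine tsum_congr fun i => ?_
  rw [Finset.sum_eq_single (φ (X i ω))]
  · simp
  · intro c _ hc
    simp [Set.indicator, hc.symm]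
  · intro h
    exact absurd (φ.mem_range_self _) h

/-- The sum depends on the enumeration only through the counts. This matters because independence of
the tiers is assumed for counting processes, not for enumerations. -/
lemma tsum_eq_iSup_sum_pointCount {Ω : Type*} (X : ℕ → Ω → Plane) {g : Plane → ℝ≥0∞}
    (hg : Measurable g) (ω : Ω) :
    ∑' i, g (X i ω) = ⨆ n, ∑ c ∈ (SimpleFunc.eapprox g n).range,
      c * (pointCount X (SimpleFunc.eapprox g n ⁻¹' {c}) ω : ℕ∞) := by
  simp_rw [← tsum_simpleFunc_apply, ← lintegral_count]
  rw [← lintegral_iSup (f := fun n i => SimpleFunc.eapprox g n (X i ω)) (fun n => .of_discrete)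
    fun _ _ h i => SimpleFunc.monotone_eapprox g h _]
  simp_rw [SimpleFunc.iSup_eapprox_apply hg]

section LaplaceFunctional

variable {Ω : Type*} [MeasurableSpace Ω] {μ : Measure Ω}

lemma IsHomogeneousPPP.lintegral_expNeg_tsum_simpleFunc [IsProbabilityMeasure μ]
    {X : ℕ → Ω → Plane} {dens : ℝ}
    (hX : IsHomogeneousPPP X dens μ) (hd : 0 ≤ dens) (φ : SimpleFunc Plane ℝ≥0∞)
    (hφ : Bornology.IsBounded (Function.support φ)) :
    ∫⁻ ω, expNeg (∑' i, φ (X i ω)) ∂μ =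
      expNeg (ENNReal.ofReal dens * ∫⁻ x, 1 - expNeg (φ x)) := by
  classical
  -- The value `0` contributes nothing, and its fibre is unbounded, so the count law would not apply
  -- to it.
  set s := φ.range.erase 0 with hs
  let e := s.equivFin.symm
  have h1 : ∀ ω, ∑' i, φ (X i ω) =
      ∑ j, (e j : ℝ≥0∞) * (pointCount X (φ ⁻¹' {(e j : ℝ≥0∞)}) ω : ℕ∞) := by
    intro ω
    rw [tsum_simpleFunc_apply, e.sum_comp fun c : s =>
      (c : ℝ≥0∞) * (pointCount X (φ ⁻¹' {(c : ℝ≥0∞)}) ω : ℕ∞), Finset.sum_coe_sort s fun c =>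
      c * (pointCount X (φ ⁻¹' {c}) ω : ℕ∞), hs, Finset.sum_erase _ (by simp)]
  have h2 : ∫⁻ x, 1 - expNeg (φ x) =
      ∑ j, volume (φ ⁻¹' {(e j : ℝ≥0∞)}) * (1 - expNeg (e j)) := by
    have := SimpleFunc.map_lintegral (μ := volume) (fun c => 1 - expNeg c) φ
    rw [← SimpleFunc.lintegral_eq_lintegral, SimpleFunc.coe_map] at this
    simp only [Function.comp_apply] at this
    rw [this, e.sum_comp fun c : s =>
      volume (φ ⁻¹' {(c : ℝ≥0∞)}) * (1 - expNeg c), Finset.sum_coe_sort s fun c =>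
      volume (φ ⁻¹' {c}) * (1 - expNeg c), hs, Finset.sum_erase _ (by simp)]
    simp_rw [mul_comm]
  simp_rw [h1]
  rw [h2]
  refine hX.lintegral_expNeg_sum_pointCount hd (fun j => φ.measurableSet_fiber _)
    (fun j => hφ.subset fun x hx => ?_) (fun i j hij => ?_) _
  · rw [Set.mem_preimage, Set.mem_singleton_iff] at hx
    rw [Function.mem_support, hx]
    exact (Finset.mem_erase.1 (e j).2).1
  · refine Set.disjoint_left.2 fun x hx hx' => hij (e.injective (Subtype.ext ?_))
    exact hx.symm.trans hx'

/-- The Laplace functional of a homogeneous Poisson point process. -/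
lemma IsHomogeneousPPP.lintegral_expNeg_tsum [IsProbabilityMeasure μ] {X : ℕ → Ω → Plane} {dens : ℝ}
    (hX : IsHomogeneousPPP X dens μ) (hd : 0 ≤ dens) {g : Plane → ℝ≥0∞} (hg : Measurable g) :
    ∫⁻ ω, expNeg (∑' i, g (X i ω)) ∂μ =
      expNeg (ENNReal.ofReal dens * ∫⁻ x, 1 - expNeg (g x)) := by
  -- Cutting off to growing balls gives bounded supports while keeping monotone convergence to `g`.
  let φ : ℕ → SimpleFunc Plane ℝ≥0∞ := fun n =>
    (SimpleFunc.eapprox g n).restrict (Metric.closedBall 0 n)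
  have hφ : ∀ n x, φ n x =
      (Metric.closedBall (0 : Plane) n).indicator (SimpleFunc.eapprox g n) x := fun n x =>
    SimpleFunc.restrict_apply _ Metric.isClosed_closedBall.measurableSet x
  have hmono : ∀ x, Monotone fun n => φ n x := by
    intro x n m hnm
    simp only [hφ]
    refine (Set.indicator_le_indicator_of_subset (Metric.closedBall_subset_closedBall
      (Nat.cast_le.2 hnm)) (fun _ => zero_le) x).trans ?_
    exact Set.indicator_le_indicator (SimpleFunc.monotone_eapprox g hnm x)
  have hlim : ∀ x, Filter.Tendsto (fun n => φ n x) Filter.atTop (nhds (g x)) := by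
    intro x
    refine (SimpleFunc.tendsto_eapprox hg x).congr' ?_
    filter_upwards [Filter.eventually_ge_atTop ⌈‖x‖⌉₊] with n hn
    rw [hφ, Set.indicator_of_mem]
    simpa using Nat.ceil_le.1 hn
  have hsupp : ∀ n, Bornology.IsBounded (Function.support (φ n)) := by
    intro n
    refine (Metric.isBounded_closedBall (x := 0) (r := n)).subset fun x hx => ?_
    rw [Function.mem_support, hφ] at hx
    exact Set.mem_of_indicator_ne_zero hx
  have hsum : ∀ ω, Filter.Tendsto (fun n => ∑' i, φ n (X i ω)) Filter.atTop
      (nhds (∑' i, g (X i ω))) := by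
    intro ω
    simp_rw [← lintegral_count]
    exact lintegral_tendsto_of_tendsto_of_monotone (fun _ => .of_discrete)
      (.of_forall fun i => hmono _) (.of_forall fun i => hlim _)
  have hleft : Filter.Tendsto (fun n => ∫⁻ ω, expNeg (∑' i, φ n (X i ω)) ∂μ) Filter.atTop
      (nhds (∫⁻ ω, expNeg (∑' i, g (X i ω)) ∂μ)) := by
    refine tendsto_lintegral_of_dominated_convergence (fun _ => 1) (fun n => ?_)
      (fun n => .of_forall fun _ => expNeg_le_one _) (by simp)
      (.of_forall fun ω => (continuous_expNeg.tendsto _).comp (hsum ω))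
    exact measurable_expNeg.comp
      (Measurable.tsum fun i => (φ n).measurable.comp (hX.measurable i))
  have hanti : Antitone expNeg := fun a b h => by
    simpa [expNeg] using h
  have hright : Filter.Tendsto
      (fun n => expNeg (ENNReal.ofReal dens * ∫⁻ x, 1 - expNeg (φ n x))) Filter.atTop
      (nhds (expNeg (ENNReal.ofReal dens * ∫⁻ x, 1 - expNeg (g x)))) := by
    refine (continuous_expNeg.tendsto _).comp (ENNReal.Tendsto.const_mul ?_ (by simp))
    refine lintegral_tendsto_of_tendsto_of_monotone
      (fun n => ((measurable_expNeg.comp (φ n).measurable).const_sub 1).aemeasurable)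
      (.of_forall fun x n m hnm => tsub_le_tsub_left (hanti (hmono x hnm)) 1)
      (.of_forall fun x => ?_)
    exact ENNReal.Tendsto.sub tendsto_const_nhds ((continuous_expNeg.tendsto _).comp (hlim x))
      (by simp)
  exact tendsto_nhds_unique hleft (hright.congr fun n =>
    (hX.lintegral_expNeg_tsum_simpleFunc hd (φ n) (hsupp n)).symm)

lemma lintegral_prod_expNeg_tsum {K : ℕ} {X : Fin K → ℕ → Ω → Plane}
    (hX : ∀ k i, Measurable (X k i)) (hXindep : iIndepFun (fun k => countingProcess (X k)) μ)
    {g : Fin K → Plane → ℝ≥0∞} (hg : ∀ k, Measurable (g k)) :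
    ∫⁻ ω, ∏ k, expNeg (∑' i, g k (X k i ω)) ∂μ =
      ∏ k, ∫⁻ ω, expNeg (∑' i, g k (X k i ω)) ∂μ := by
  let Ψ : ∀ k : Fin K, ({A : Set Plane // MeasurableSet A} → ℕ∞) → ℝ≥0∞ := fun k N =>
    expNeg (⨆ n, ∑ c ∈ (SimpleFunc.eapprox (g k) n).range,
      c * (N ⟨SimpleFunc.eapprox (g k) n ⁻¹' {c}, SimpleFunc.measurableSet_fiber _ _⟩ : ℕ∞))
  have hΨ : ∀ k, Measurable (Ψ k) := fun k =>
    measurable_expNeg.comp (.iSup fun n => Finset.measurable_sum _ fun c _ =>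
      ((Measurable.of_discrete (f := fun n : ℕ∞ => (n : ℝ≥0∞))).comp
        (measurable_pi_apply _)).const_mul _)
  have hΨX : ∀ k ω, expNeg (∑' i, g k (X k i ω)) = Ψ k (countingProcess (X k) ω) := by
    intro k ω
    rw [tsum_eq_iSup_sum_pointCount _ (hg k)]
    rfl
  simp_rw [hΨX]
  exact lintegral_prod_eq_prod_lintegral_of_indepFun Finset.univ
    (fun k ω => Ψ k (countingProcess (X k) ω)) (hXindep.comp Ψ hΨ)
    fun k => (hΨ k).comp (measurable_countingProcess (hX k))

end LaplaceFunctional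

/-! ### Independent marking -/

section Marks

variable {Ω : Type*} [MeasurableSpace Ω] {μ : Measure Ω}

/-- By Fubini the locations can be frozen; the marks remain independent, so the inner expectation
factorizes. -/
lemma lintegral_prod_marks {ι E : Type*} [MeasurableSpace E] [IsProbabilityMeasure μ]
    {X : ι → Ω → E} (hX : ∀ p, Measurable (X p)) {χ : ι → Ω → ℝ} (hχ : ∀ p, Measurable (χ p))
    (hχindep : iIndepFun χ μ)
    (hχX : IndepFun (fun ω p => χ p ω) (fun ω p => X p ω) μ)
    {F : ι → E × ℝ → ℝ≥0∞} (hF : ∀ p, Measurable (F p)) (s : Finset ι) :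
    ∫⁻ ω, ∏ p ∈ s, F p (X p ω, χ p ω) ∂μ =
      ∫⁻ ω, ∏ p ∈ s, ∫⁻ t, F p (X p ω, t) ∂(μ.map (χ p)) ∂μ := by
  have hmχ : Measurable fun ω p => χ p ω := measurable_pi_lambda _ hχ
  have hmX : Measurable fun ω p => X p ω := measurable_pi_lambda _ hX
  have hprob : ∀ p, IsProbabilityMeasure (μ.map (χ p)) := fun p =>
    Measure.isProbabilityMeasure_map (hχ p).aemeasurable
  have hprobχ : IsProbabilityMeasure (μ.map fun ω p => χ p ω) :=
    Measure.isProbabilityMeasure_map hmχ.aemeasurable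
  have hprobX : IsProbabilityMeasure (μ.map fun ω p => X p ω) :=
    Measure.isProbabilityMeasure_map hmX.aemeasurable
  have hG : Measurable fun z : (ι → ℝ) × (ι → E) => ∏ p ∈ s, F p (z.2 p, z.1 p) :=
    Finset.measurable_prod _ fun p _ => (hF p).comp
      (((measurable_pi_apply p).comp measurable_snd).prodMk
        ((measurable_pi_apply p).comp measurable_fst))
  have hH : Measurable fun x : ι → E => ∏ p ∈ s, ∫⁻ t, F p (x p, t) ∂(μ.map (χ p)) :=
    Finset.measurable_prod _ fun p _ =>
      (hF p).lintegral_prod_right'.comp (measurable_pi_apply p)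
  rw [← lintegral_map (μ := μ) hG (hmχ.prodMk hmX),
    (indepFun_iff_map_prod_eq_prod_map_map hmχ.aemeasurable hmX.aemeasurable).1 hχX,
    lintegral_prod_symm _ hG.aemeasurable, ← lintegral_map (μ := μ) hH hmX]
  refine lintegral_congr fun x => ?_
  have hFx : ∀ p, Measurable fun t => F p (x p, t) := fun p =>
    (hF p).comp measurable_prodMk_left
  have hGx : Measurable fun z : ι → ℝ => ∏ p ∈ s, F p (x p, z p) :=
    hG.comp (measurable_prodMk_right (y := x))
  refine (lintegral_map hGx hmχ).trans ?_
  refine (lintegral_prod_eq_prod_lintegral_of_indepFun s (fun p ω => F p (x p, χ p ω))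
    (hχindep.comp (fun p t => F p (x p, t)) hFx) fun p => (hFx p).comp (hχ p)).trans ?_
  exact Finset.prod_congr rfl fun p _ => (lintegral_map (hFx p) (hχ p)).symm

/-- The Laplace functional of independent, independently marked Poisson point processes. -/
lemma lintegral_expNeg_tsum_marked [IsProbabilityMeasure μ] {K : ℕ} {dens : Fin K → ℝ}
    (hdens : ∀ k, 0 ≤ dens k) {X : Fin K → ℕ → Ω → Plane}
    (hX : ∀ k, IsHomogeneousPPP (X k) (dens k) μ)
    (hXindep : iIndepFun (fun k => countingProcess (X k)) μ)
    {ν : Fin K → Measure ℝ} {χ : Fin K → ℕ → Ω → ℝ} (hχ : ∀ k i, Measurable (χ k i))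
    (hχlaw : ∀ k i, μ.map (χ k i) = ν k)
    (hχindep : iIndepFun (fun p : Fin K × ℕ => χ p.1 p.2) μ)
    (hχX : IndepFun (fun ω (p : Fin K × ℕ) => χ p.1 p.2 ω)
      (fun ω (p : Fin K × ℕ) => X p.1 p.2 ω) μ)
    {h : Fin K → Plane × ℝ → ℝ≥0∞} (hh : ∀ k, Measurable (h k)) :
    ∫⁻ ω, expNeg (∑' p : Fin K × ℕ, h p.1 (X p.1 p.2 ω, χ p.1 p.2 ω)) ∂μ =
      expNeg (∑ k, ENNReal.ofReal (dens k) *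
        ∫⁻ x, ∫⁻ t, 1 - expNeg (h k (x, t)) ∂(ν k)) := by
  have hν : ∀ k, IsProbabilityMeasure (ν k) := fun k => by
    rw [← hχlaw k 0]
    exact Measure.isProbabilityMeasure_map (hχ k 0).aemeasurable
  have hmX : ∀ k i, Measurable (X k i) := fun k => (hX k).measurable
  have hF : ∀ k, Measurable fun z => expNeg (h k z) := fun k => measurable_expNeg.comp (hh k)
  have hf : ∀ k, Measurable fun x => ∫⁻ t, expNeg (h k (x, t)) ∂(ν k) := fun k =>
    (hF k).lintegral_prod_right'
  have hf1 : ∀ k x, ∫⁻ t, expNeg (h k (x, t)) ∂(ν k) ≤ 1 := fun k x =>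
    (lintegral_mono fun t => expNeg_le_one _).trans (by simp)
  -- For finite products the marks may be averaged out, replacing `h` by `g`; both sides then pass
  -- to the limit over finite index sets.
  choose g hg hgf using fun k => exists_expNeg_eq (hf k) (hf1 k)
  have hlim : Filter.Tendsto (fun s : Finset (Fin K × ℕ) =>
      ∫⁻ ω, ∏ p ∈ s, expNeg (h p.1 (X p.1 p.2 ω, χ p.1 p.2 ω)) ∂μ) Filter.atTop
      (nhds (∫⁻ ω, expNeg (∑' p : Fin K × ℕ, h p.1 (X p.1 p.2 ω, χ p.1 p.2 ω)) ∂μ)) := by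
    refine tendsto_lintegral_filter_of_dominated_convergence (fun _ => 1)
      (.of_forall fun s => ?_) (.of_forall fun s => .of_forall fun ω => ?_) (by simp)
      (.of_forall fun ω => tendsto_prod_expNeg _)
    · exact Finset.measurable_prod _ fun p _ => (hF p.1).comp ((hmX _ _).prodMk (hχ _ _))
    · exact Finset.prod_le_one' fun _ _ => expNeg_le_one _
  have hlim' : Filter.Tendsto (fun s : Finset (Fin K × ℕ) =>
      ∫⁻ ω, ∏ p ∈ s, expNeg (g p.1 (X p.1 p.2 ω)) ∂μ) Filter.atTop
      (nhds (∫⁻ ω, expNeg (∑' p : Fin K × ℕ, g p.1 (X p.1 p.2 ω)) ∂μ)) := by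
    refine tendsto_lintegral_filter_of_dominated_convergence (fun _ => 1)
      (.of_forall fun s => ?_) (.of_forall fun s => .of_forall fun ω => ?_) (by simp)
      (.of_forall fun ω => tendsto_prod_expNeg _)
    · exact Finset.measurable_prod _ fun p _ => measurable_expNeg.comp ((hg p.1).comp (hmX _ _))
    · exact Finset.prod_le_one' fun _ _ => expNeg_le_one _
  have heq : ∀ s : Finset (Fin K × ℕ),
      ∫⁻ ω, ∏ p ∈ s, expNeg (h p.1 (X p.1 p.2 ω, χ p.1 p.2 ω)) ∂μ =
      ∫⁻ ω, ∏ p ∈ s, expNeg (g p.1 (X p.1 p.2 ω)) ∂μ := by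
    intro s
    have := lintegral_prod_marks (X := fun p : Fin K × ℕ => X p.1 p.2) (fun p => hmX _ _)
      (fun p => hχ _ _) hχindep hχX (F := fun p z => expNeg (h p.1 z)) (fun p => hF p.1) s
    simpa only [hχlaw, ← hgf] using this
  simp_rw [heq] at hlim
  rw [tendsto_nhds_unique hlim hlim']
  have hsplit : ∀ ω, expNeg (∑' p : Fin K × ℕ, g p.1 (X p.1 p.2 ω)) =
      ∏ k, expNeg (∑' i, g k (X k i ω)) := by
    intro ω
    rw [ENNReal.tsum_prod (f := fun k i => g k (X k i ω)), tsum_fintype, expNeg_sum]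
  simp_rw [hsplit]
  rw [lintegral_prod_expNeg_tsum hmX hXindep hg, expNeg_sum]
  refine Finset.prod_congr rfl fun k _ => ?_
  rw [(hX k).lintegral_expNeg_tsum (hdens k) (hg k)]
  congr 2
  refine lintegral_congr fun x => ?_
  have hFx : Measurable fun t => expNeg (h k (x, t)) := (hF k).comp measurable_prodMk_left
  rw [hgf, lintegral_sub hFx
    ((hf1 k x).trans_lt ENNReal.one_lt_top).ne (.of_forall fun t => expNeg_le_one _)]
  simp

end Marks

/-! ### Path losses as points of the half-line -/

/-- The power `b * (t * ‖x‖ ^ (-α))`, raised to the exponent `-2 / α`: it decreases in the power,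
and is proportional to the squared distance. -/
noncomputable def pathLoss (α b : ℝ) (z : Plane × ℝ) : ℝ :=
  (b * (z.2 * ‖z.1‖ ^ (-α))) ^ (-(2 / α))

lemma measurable_pathLoss (α b : ℝ) : Measurable (pathLoss α b) := by
  unfold pathLoss
  fun_prop

lemma pathLoss_eq {α b t : ℝ} (hα : 0 < α) (hb : 0 < b) (ht : 0 < t) (x : Plane) :
    pathLoss α b (x, t) = ‖x‖ ^ 2 / (b ^ (2 / α) * t ^ (2 / α)) := by
  -- At the origin both sides are `0`, because `0` to a nonzero real power is `0` by convention.
  rcases eq_or_ne x 0 with rfl | hx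
  · simp [pathLoss, Real.zero_rpow (neg_ne_zero.2 hα.ne'),
      Real.zero_rpow (neg_ne_zero.2 (div_pos two_pos hα).ne')]
  · have hx : 0 < ‖x‖ := norm_pos_iff.2 hx
    rw [pathLoss, ← mul_assoc, Real.mul_rpow (by positivity) (by positivity),
      ← Real.rpow_mul hx.le, show -α * -(2 / α) = (2 : ℕ) by field_simp; norm_num,
      Real.rpow_natCast, Real.rpow_neg (by positivity), Real.mul_rpow hb.le ht.le]
    ring

lemma volume_pathLoss_mem_Ioc {α b t a c : ℝ} (hα : 0 < α) (hb : 0 < b) (ht : 0 < t) (ha : 0 ≤ a)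
    (hac : a ≤ c) : volume {x : Plane | pathLoss α b (x, t) ∈ Set.Ioc a c} =
      ENNReal.ofReal (Real.pi * (c - a) * b ^ (2 / α) * t ^ (2 / α)) := by
  set w := b ^ (2 / α) * t ^ (2 / α) with hw
  have hw0 : 0 < w := by positivity
  have hball : ∀ r, 0 ≤ r → volume (Metric.closedBall (0 : Plane) (√(r * w))) =
      ENNReal.ofReal (Real.pi * r * w) := by
    intro r hr
    rw [EuclideanSpace.volume_closedBall_fin_two, ← ENNReal.ofReal_pow (by positivity),
      Real.sq_sqrt (by positivity), ← ENNReal.ofReal_mul (by positivity)]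
    congr 1
    ring
  have hset : {x : Plane | pathLoss α b (x, t) ∈ Set.Ioc a c} =
      Metric.closedBall 0 (√(c * w)) \ Metric.closedBall 0 (√(a * w)) := by
    ext x
    have hsqrt : ∀ r, 0 ≤ r → (‖x‖ ≤ √(r * w) ↔ ‖x‖ ^ 2 ≤ r * w) := fun r hr =>
      Real.le_sqrt (norm_nonneg x) (mul_nonneg hr hw0.le)
    rw [Set.mem_ofPred_eq, Set.mem_Ioc, pathLoss_eq hα hb ht, ← hw, Set.mem_sdiff,
      mem_closedBall_zero_iff, mem_closedBall_zero_iff, hsqrt c (ha.trans hac), hsqrt a ha,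
      lt_div_iff₀ hw0, div_le_iff₀ hw0, not_le, and_comm]
  rw [hset, measure_sdiff (Metric.closedBall_subset_closedBall (by gcongr))
    Metric.isClosed_closedBall.nullMeasurableSet measure_closedBall_lt_top.ne,
    hball c (ha.trans hac), hball a ha, ← ENNReal.ofReal_sub _ (by positivity)]
  congr 1
  rw [hw]
  ring

/-- After swapping the integrals, each fixed mark `t` contributes the area of an annulus, linear in
`t ^ (2 / α)`. Hence only this moment of the mark law survives. -/
lemma lintegral_pathLoss_Ioc {α b a c : ℝ} (hα : 0 < α) (hb : 0 < b) (ha : 0 ≤ a) (hac : a ≤ c)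
    {ν : Measure ℝ} [SFinite ν] (hνpos : ∀ᵐ t ∂ν, 0 < t)
    (hν : Integrable (fun t : ℝ => t ^ (2 / α)) ν) (θ : ℝ≥0∞) :
    ∫⁻ x : Plane, ∫⁻ t,
      1 - expNeg (θ * (Set.Ioc a c).indicator 1 (pathLoss α b (x, t))) ∂ν =
      ENNReal.ofReal (Real.pi * b ^ (2 / α) * (∫ t, t ^ (2 / α) ∂ν) * (c - a)) *
        (1 - expNeg θ) := by
  have hm : Measurable fun z : Plane × ℝ => (Set.Ioc a c).indicator (1 : ℝ → ℝ≥0∞) (pathLoss α b z) :=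
    (measurable_one.indicator measurableSet_Ioc).comp (measurable_pathLoss α b)
  have h1 : ∀ y : ℝ, 1 - expNeg (θ * (Set.Ioc a c).indicator 1 y) =
      (Set.Ioc a c).indicator 1 y * (1 - expNeg θ) := by
    intro y
    by_cases hy : y ∈ Set.Ioc a c <;> simp [hy]
  simp_rw [h1]
  have hmul : ∀ x : Plane, ∫⁻ t, (Set.Ioc a c).indicator 1 (pathLoss α b (x, t)) * (1 - expNeg θ) ∂ν
      = (∫⁻ t, (Set.Ioc a c).indicator 1 (pathLoss α b (x, t)) ∂ν) * (1 - expNeg θ) := fun x =>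
    lintegral_mul_const _ (hm.comp measurable_prodMk_left)
  simp_rw [hmul]
  rw [lintegral_mul_const _ hm.lintegral_prod_right', lintegral_lintegral_swap hm.aemeasurable]
  congr 1
  have h2 : ∀ᵐ t ∂ν, ∫⁻ x : Plane, (Set.Ioc a c).indicator 1 (pathLoss α b (x, t)) =
      ENNReal.ofReal (Real.pi * (c - a) * b ^ (2 / α) * t ^ (2 / α)) := by
    filter_upwards [hνpos] with t ht
    rw [← volume_pathLoss_mem_Ioc hα hb ht ha hac, ← lintegral_indicator_one]
    · rfl
    · exact ((measurable_pathLoss α b).comp measurable_prodMk_right) measurableSet_Ioc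
  have hca : 0 ≤ c - a := sub_nonneg.2 hac
  rw [lintegral_congr_ae h2, ← ofReal_integral_eq_lintegral_ofReal (hν.const_mul _)]
  · rw [integral_const_mul]
    congr 1
    ring
  · filter_upwards [hνpos] with t ht
    positivity

/-! ### Poisson families: local finiteness and absence of ties -/

/-- The families `T (k, 0), T (k, 1), …` of positive reals form independent Poisson point processes
of intensities `m k`, expressed by the generating functions of their numbers of points in
intervals. -/
structure IsPoissonFamily {Ω κ : Type*} [MeasurableSpace Ω] [Fintype κ] (T : κ × ℕ → Ω → ℝ)
    (m : κ → ℝ) (μ : Measure Ω) : Prop where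
  measurable : ∀ p, Measurable (T p)
  pos : ∀ᵐ ω ∂μ, ∀ p, 0 < T p ω
  rate_pos : ∀ k, 0 < m k
  laplace : ∀ (θ : ℝ≥0∞) (a c : κ → ℝ), (∀ k, 0 ≤ a k) → (∀ k, a k ≤ c k) →
    ∫⁻ ω, expNeg (∑' p : κ × ℕ, θ * (Set.Ioc (a p.1) (c p.1)).indicator 1 (T p ω)) ∂μ =
      expNeg (ENNReal.ofReal (∑ k, m k * (c k - a k)) * (1 - expNeg θ))

namespace IsPoissonFamily

variable {Ω κ : Type*} [MeasurableSpace Ω] [Fintype κ] {T : κ × ℕ → Ω → ℝ} {m : κ → ℝ}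
  {μ : Measure Ω} [IsProbabilityMeasure μ]

/-- The number `N` of points satisfies `1_{N ≥ 2} ≤ 2 + 2 · 0^N - 4 · (1/2)^N`, with equality for `N
= 0, 1`. Since `E[z^N] = exp (-x (1 - z))` with `x` the mean, the right side has expectation `2 (1 -
exp (-x/2))² ≤ x²`. -/
lemma measure_two_points_le (hT : IsPoissonFamily T m μ) {a c : ℝ} (ha : 0 ≤ a)
    (hac : a ≤ c) :
    μ {ω | ∃ p q, p ≠ q ∧ T p ω ∈ Set.Ioc a c ∧ T q ω ∈ Set.Ioc a c} ≤
      ENNReal.ofReal (((∑ k, m k) * (c - a)) ^ 2) := by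
  classical
  set S := {ω | ∃ p q, p ≠ q ∧ T p ω ∈ Set.Ioc a c ∧ T q ω ∈ Set.Ioc a c} with hS
  set x := (∑ k, m k) * (c - a) with hx
  have hx0 : 0 ≤ x := mul_nonneg (Finset.sum_nonneg fun k _ => (hT.rate_pos k).le)
    (sub_nonneg.2 hac)
  let N : Ω → ℝ≥0∞ := fun ω => ∑' p : κ × ℕ, (Set.Ioc a c).indicator 1 (T p ω)
  have hN : Measurable N := Measurable.tsum fun p =>
    (measurable_one.indicator measurableSet_Ioc).comp (hT.measurable p)
  have hSm : MeasurableSet S := by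
    have : S = ⋃ p, ⋃ q, ⋃ _ : p ≠ q, T p ⁻¹' Set.Ioc a c ∩ T q ⁻¹' Set.Ioc a c := by
      ext ω
      simp only [hS, Set.mem_ofPred_eq, Set.mem_iUnion, Set.mem_inter_iff, Set.mem_preimage,
        exists_prop]
    rw [this]
    exact .iUnion fun p => .iUnion fun q => .iUnion fun _ =>
      (hT.measurable p measurableSet_Ioc).inter (hT.measurable q measurableSet_Ioc)
  have hlap : ∀ θ, ∫⁻ ω, expNeg (θ * N ω) ∂μ = expNeg (ENNReal.ofReal x * (1 - expNeg θ)) := by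
    intro θ
    have := hT.laplace θ (fun _ => a) (fun _ => c) (fun _ => ha) fun _ => hac
    simpa only [N, ENNReal.tsum_mul_left, ← Finset.sum_mul, ← hx] using this
  have hexp : ∀ n : ℕ, expNeg (ENNReal.ofReal (Real.log 2) * n) = (1 / 2) ^ n := by
    intro n
    rw [expNeg_mul_natCast, expNeg_ofReal (Real.log_nonneg one_le_two), Real.exp_neg,
      Real.exp_log two_pos, ENNReal.ofReal_inv_of_pos two_pos]
    simp
  have hhalf : expNeg (ENNReal.ofReal (Real.log 2)) = 1 / 2 := by simpa using hexp 1
  have h4 : (4 : ℝ≥0∞) * (1 / 2) ^ 2 = 1 := by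
    rw [show (4 : ℝ≥0∞) = 2 ^ 2 by norm_num, ← mul_pow, one_div,
      ENNReal.mul_inv_cancel (by norm_num) (by norm_num), one_pow]
  have hpt : ∀ ω, S.indicator 1 ω + 4 * expNeg (ENNReal.ofReal (Real.log 2) * N ω) ≤
      2 + 2 * expNeg (∞ * N ω) := by
    intro ω
    by_cases hω : ω ∈ S
    · obtain ⟨p, q, hpq, hp, hq⟩ := id hω
      have h2 : ((2 : ℕ) : ℝ≥0∞) ≤ N ω := by
        refine le_trans ?_ (ENNReal.sum_le_tsum {p, q})
        simp [Finset.sum_pair hpq, hp, hq, one_add_one_eq_two]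
      have : 4 * expNeg (ENNReal.ofReal (Real.log 2) * N ω) ≤ 1 := by
        rw [← h4, ← hexp]
        gcongr
        simp only [expNeg, EReal.exp_le_exp_iff, EReal.neg_le_neg_iff,
          EReal.coe_ennreal_le_coe_ennreal_iff]
        gcongr
      rw [Set.indicator_of_mem hω, Pi.one_apply]
      exact (add_le_add_right this 1).trans (one_add_one_eq_two.le.trans le_self_add)
    · rw [Set.indicator_of_notMem hω, zero_add]
      by_cases h : ∃ p, T p ω ∈ Set.Ioc a c
      · obtain ⟨p, hp⟩ := h
        have hN1 : N ω = 1 := by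
          simp only [N]
          rw [tsum_eq_single p]
          · simp [hp]
          · intro q hq
            rw [Set.indicator_of_notMem]
            exact fun hq' => hω ⟨p, q, hq.symm, hp, hq'⟩
        rw [hN1, mul_one, mul_one, hhalf, expNeg_top, mul_zero, add_zero,
          show (4 : ℝ≥0∞) = 2 * 2 by norm_num, mul_assoc, one_div,
          ENNReal.mul_inv_cancel (by norm_num) (by norm_num), mul_one]
      · have hN0 : N ω = 0 := by
          simp only [N, ENNReal.tsum_eq_zero]
          exact fun p => Set.indicator_of_notMem (fun hp => h ⟨p, hp⟩) _
        rw [hN0]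
        norm_num
  have hE : ∀ θ, Measurable fun ω => expNeg (θ * N ω) := fun θ =>
    measurable_expNeg.comp (hN.const_mul θ)
  have hint := lintegral_mono (μ := μ) hpt
  rw [lintegral_add_left (measurable_one.indicator hSm), lintegral_indicator_one hSm,
    lintegral_const_mul _ (hE _),
    lintegral_add_left measurable_const,
    lintegral_const_mul _ (hE _), hlap, hlap, hhalf, expNeg_top,
    lintegral_const, measure_univ, mul_one, tsub_zero, mul_one, one_div,
    ENNReal.one_sub_inv_two, ← ENNReal.ofReal_ofNat 2, ← ENNReal.ofReal_inv_of_pos two_pos,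
    ← ENNReal.ofReal_mul hx0, expNeg_ofReal (by positivity), expNeg_ofReal hx0,
    ← ENNReal.ofReal_mul two_pos.le, ← ENNReal.ofReal_add two_pos.le (by positivity),
    ← ENNReal.ofReal_ofNat 4, ← ENNReal.ofReal_mul (by norm_num)] at hint
  have hle := ENNReal.le_sub_of_add_le_right ENNReal.ofReal_ne_top hint
  rw [← ENNReal.ofReal_sub _ (by positivity)] at hle
  refine hle.trans (ENNReal.ofReal_le_ofReal ?_)
  have hsq : Real.exp (-x) = Real.exp (-(x * 2⁻¹)) ^ 2 := by
    rw [← Real.exp_nat_mul]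
    congr 1
    push_cast
    ring
  have h5 : 1 - Real.exp (-(x * 2⁻¹)) ≤ x * 2⁻¹ := by
    linarith [Real.add_one_le_exp (-(x * 2⁻¹))]
  have h6 : 0 ≤ 1 - Real.exp (-(x * 2⁻¹)) := by
    have := Real.exp_le_one_iff.2 (neg_nonpos.2 (by positivity : 0 ≤ x * 2⁻¹))
    linarith
  rw [hsq]
  nlinarith [mul_self_le_mul_self h6 h5]

/-- Each of the `n + 1` cells holds two points with probability at most `(C / (n + 1))²`, so level
`n` fails with probability at most `C² / (n + 1)`, which tends to `0`. -/
lemma ae_exists_partition (hT : IsPoissonFamily T m μ) {r : ℝ} (hr : 0 < r) :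
    ∀ᵐ ω ∂μ, ∃ n : ℕ, ∀ j < n + 1, ∀ p q,
      T p ω ∈ Set.Ioc (r / (n + 1) * j) (r / (n + 1) * (j + 1)) →
      T q ω ∈ Set.Ioc (r / (n + 1) * j) (r / (n + 1) * (j + 1)) → p = q := by
  set C := (∑ k, m k) * r
  have hbound : ∀ n : ℕ, μ {ω | ¬ ∃ n : ℕ, ∀ j < n + 1, ∀ p q,
      T p ω ∈ Set.Ioc (r / (n + 1) * j) (r / (n + 1) * (j + 1)) →
      T q ω ∈ Set.Ioc (r / (n + 1) * j) (r / (n + 1) * (j + 1)) → p = q} ≤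
      ENNReal.ofReal (C ^ 2 / (n + 1)) := by
    intro n
    calc _ ≤ μ (⋃ j ∈ Finset.range (n + 1), {ω | ∃ p q, p ≠ q ∧
          T p ω ∈ Set.Ioc (r / (n + 1) * j) (r / (n + 1) * (j + 1)) ∧
          T q ω ∈ Set.Ioc (r / (n + 1) * j) (r / (n + 1) * (j + 1))}) := by
          refine measure_mono fun ω hω => ?_
          simp only [Set.mem_ofPred_eq, not_exists] at hω
          have := hω n
          push Not at this
          obtain ⟨j, hj, p, q, hp, hq, hpq⟩ := this
          simp only [Set.mem_iUnion]
          exact ⟨j, Finset.mem_range.2 hj, p, q, hpq, hp, hq⟩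
      _ ≤ ∑ j ∈ Finset.range (n + 1), ENNReal.ofReal ((C / (n + 1)) ^ 2) := by
          refine (measure_biUnion_finset_le _ _).trans (Finset.sum_le_sum fun j _ => ?_)
          refine (hT.measure_two_points_le (by positivity) (by gcongr; simp)).trans_eq ?_
          congr 2
          simp only [C]
          ring
      _ = _ := by
          rw [Finset.sum_const, Finset.card_range, nsmul_eq_mul, ← ENNReal.ofReal_natCast,
            ← ENNReal.ofReal_mul (by positivity)]
          congr 1
          push_cast
          field_simp
  rw [ae_iff]
  have := (tendsto_one_div_add_atTop_nhds_zero_nat (𝕜 := ℝ)).const_mul (C ^ 2)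
  rw [mul_zero] at this
  have hlim : Filter.Tendsto (fun n : ℕ => ENNReal.ofReal (C ^ 2 / (n + 1))) Filter.atTop
      (nhds 0) := by
    simpa [div_eq_mul_inv] using ENNReal.tendsto_ofReal this
  exact le_antisymm (ge_of_tendsto' hlim hbound) zero_le

lemma finite_and_injOn_of_partition {ι : Type*} {t : ι → ℝ} {r : ℝ} (hr : 0 < r) {n : ℕ}
    (h : ∀ j < n + 1, ∀ p q,
      t p ∈ Set.Ioc (r / (n + 1) * j) (r / (n + 1) * (j + 1)) →
      t q ∈ Set.Ioc (r / (n + 1) * j) (r / (n + 1) * (j + 1)) → p = q) :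
    {p | t p ∈ Set.Ioc 0 r}.Finite ∧ Set.InjOn t {p | t p ∈ Set.Ioc 0 r} := by
  have hs : 0 < r / (n + 1) := by positivity
  have hcell : ∀ p, t p ∈ Set.Ioc 0 r → ∃ j < n + 1,
      t p ∈ Set.Ioc (r / (n + 1) * j) (r / (n + 1) * (j + 1)) := by
    intro p hp
    have hq : 0 < t p / (r / (n + 1)) := div_pos hp.1 hs
    -- Cells are open on the left and closed on the right, so the cell index is the ceiling minus
    -- one.
    obtain ⟨j, hj⟩ := Nat.exists_eq_succ_of_ne_zero (Nat.ceil_pos.2 hq).ne'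
    have hlt := Nat.ceil_lt_add_one hq.le
    have hle := Nat.le_ceil (t p / (r / (n + 1)))
    have hle' : t p / (r / (n + 1)) ≤ (n + 1 : ℕ) := by
      rw [div_le_iff₀ hs]
      refine hp.2.trans_eq ?_
      push_cast
      field_simp
    rw [← Nat.ceil_le] at hle'
    rw [hj] at hlt hle hle'
    push_cast at hlt hle
    refine ⟨j, hle', ?_, ?_⟩
    · rw [mul_comm, ← lt_div_iff₀ hs]
      linarith
    · rwa [mul_comm, ← div_le_iff₀ hs]
  choose! j hj hmem using hcell
  have hinj : Set.InjOn j {p | t p ∈ Set.Ioc 0 r} := fun p hp q hq hpq =>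
    h (j p) (hj p hp) p q (hmem p hp) (hpq ▸ hmem q hq)
  refine ⟨Set.Finite.of_injOn (fun p hp => Set.mem_Iio.2 (hj p hp)) hinj (Set.finite_Iio (n + 1)),
    fun p hp q hq hpq => h (j p) (hj p hp) p q (hmem p hp) (hpq ▸ hmem p hp)⟩

lemma ae_finite_and_injective (hT : IsPoissonFamily T m μ) :
    ∀ᵐ ω ∂μ, (∀ r, {p | T p ω ≤ r}.Finite) ∧ Function.Injective fun p => T p ω := by
  have h : ∀ᵐ ω ∂μ, ∀ r : ℕ, {p | T p ω ∈ Set.Ioc 0 ((r : ℝ) + 1)}.Finite ∧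
      Set.InjOn (fun p => T p ω) {p | T p ω ∈ Set.Ioc 0 ((r : ℝ) + 1)} := by
    refine ae_all_iff.2 fun r => ?_
    filter_upwards [hT.ae_exists_partition (r := (r : ℝ) + 1) (by positivity)] with ω hω
    obtain ⟨n, hn⟩ := hω
    exact finite_and_injOn_of_partition (t := fun p => T p ω) (by positivity) hn
  filter_upwards [h, hT.pos] with ω hω hpos
  refine ⟨fun r => ?_, fun p q hpq => ?_⟩
  · obtain ⟨n, hn⟩ := exists_nat_ge r
    exact (hω n).1.subset fun p (hp : T p ω ≤ r) => ⟨hpos p, hp.trans (by linarith)⟩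
  · obtain ⟨n, hn⟩ := exists_nat_ge (T p ω)
    have hp : T p ω ∈ Set.Ioc 0 ((n : ℝ) + 1) := ⟨hpos p, by linarith⟩
    exact (hω n).2 hp (show T q ω ∈ _ from (show T p ω = T q ω from hpq) ▸ hp) hpq

end IsPoissonFamily

/-! ### The first point of a Poisson family -/

lemma exists_forall_le_of_finite {ι : Type*} {t : ι → ℝ} (ht : ∀ r, {p | t p ≤ r}.Finite)
    {S : Set ι} (hS : S.Nonempty) : ∃ p ∈ S, ∀ q ∈ S, t p ≤ t q := by
  obtain ⟨p₀, hp₀⟩ := hS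
  obtain ⟨p, ⟨hp, hpS⟩, hmin⟩ := Set.exists_min_image ({p | t p ≤ t p₀} ∩ S) t
    ((ht (t p₀)).inter_of_left S) ⟨p₀, le_refl (t p₀), hp₀⟩
  refine ⟨p, hpS, fun q hq => ?_⟩
  rcases le_total (t q) (t p₀) with h | h
  · exact hmin q ⟨h, hq⟩
  · exact le_trans hp h

namespace IsPoissonFamily

variable {Ω κ : Type*} [MeasurableSpace Ω] [Fintype κ] {T : κ × ℕ → Ω → ℝ} {m : κ → ℝ}
  {μ : Measure Ω}

lemma measurableSet_void (hT : IsPoissonFamily T m μ) (r : κ → ℝ) :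
    MeasurableSet {ω | ∀ p, T p ω ∉ Set.Ioc 0 (r p.1)} := by
  rw [Set.ofPred_forall]
  exact .iInter fun p => (hT.measurable p measurableSet_Ioc).compl

lemma measure_void (hT : IsPoissonFamily T m μ) {r : κ → ℝ} (hr : ∀ k, 0 ≤ r k) :
    μ {ω | ∀ p, T p ω ∉ Set.Ioc 0 (r p.1)} = ENNReal.ofReal (Real.exp (-∑ k, m k * r k)) := by
  -- At `θ = ∞` the integrand is the indicator that there are no points, since `∞ * 0 = 0`.
  have h := hT.laplace ∞ (fun _ => 0) r (fun _ => le_rfl) hr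
  simp only [sub_zero, expNeg_top, tsub_zero, mul_one] at h
  rw [← expNeg_ofReal (Finset.sum_nonneg fun k _ => mul_nonneg (hT.rate_pos k).le (hr k)), ← h,
    ← lintegral_indicator_one (hT.measurableSet_void r)]
  refine lintegral_congr fun ω => ?_
  by_cases hω : ∀ p, T p ω ∉ Set.Ioc 0 (r p.1)
  · rw [Set.indicator_of_mem (by exact hω)]
    have : ∑' p : κ × ℕ, ∞ * (Set.Ioc 0 (r p.1)).indicator (1 : ℝ → ℝ≥0∞) (T p ω) = 0 :=
      ENNReal.tsum_eq_zero.2 fun p => by rw [Set.indicator_of_notMem (hω p), mul_zero]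
    rw [this, expNeg_zero, Pi.one_apply]
  · rw [Set.indicator_of_notMem (by exact hω)]
    push Not at hω
    obtain ⟨p, hp⟩ := hω
    have : ∑' p : κ × ℕ, ∞ * (Set.Ioc 0 (r p.1)).indicator (1 : ℝ → ℝ≥0∞) (T p ω) = ∞ :=
      ENNReal.tsum_eq_top_of_eq_top ⟨p, by rw [Set.indicator_of_mem hp]; simp⟩
    rw [this, expNeg_top]

lemma measurableSet_first (hT : IsPoissonFamily T m μ) (k : κ) :
    MeasurableSet {ω | ∃ i, ∀ p, T (k, i) ω ≤ T p ω} := by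
  simp_rw [Set.ofPred_exists, Set.ofPred_forall]
  exact .iUnion fun i => .iInter fun p => measurableSet_le (hT.measurable _) (hT.measurable p)

variable [IsProbabilityMeasure μ]

/-- On a grid of step `h`, family `k` surely wins if the first occupied cell contains points of
family `k` only. Summing the probabilities of this over the cells gives a geometric series; ties
within a cell cost only the exponential factor. -/
lemma le_measureReal_first_of_step (hT : IsPoissonFamily T m μ) (k : κ) {h : ℝ} (hh : 0 < h) :
    m k / (∑ j, m j) * Real.exp (-((∑ j, m j) * h)) ≤
      μ.real {ω | ∃ i, ∀ p, T (k, i) ω ≤ T p ω} := by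
  classical
  set C := ∑ j, m j with hC
  have hC0 : 0 < C := Finset.sum_pos (fun j _ => hT.rate_pos j) ⟨k, Finset.mem_univ k⟩
  -- Emptiness up to `r n` leaves cell `n` free only for family `k`. Removing emptiness up to `h *
  -- (n + 1)` forces a point of family `k` there.
  let r : ℕ → κ → ℝ := fun n => Function.update (fun _ => h * (n + 1)) k (h * n)
  have hr0 : ∀ n j, 0 ≤ r n j := by
    intro n j
    rcases eq_or_ne j k with rfl | hj
    · simp only [r, Function.update_self]; positivity
    · simp only [r, Function.update_of_ne hj]; positivity
  have hrk : ∀ n, r n k = h * n := fun n => Function.update_self ..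
  have hrj : ∀ n j, j ≠ k → r n j = h * (n + 1) := fun n j hj => Function.update_of_ne hj ..
  have hrle : ∀ n j, r n j ≤ h * (n + 1) := by
    intro n j
    rcases eq_or_ne j k with rfl | hj
    · rw [hrk]; gcongr; simp
    · rw [hrj n j hj]
  have hrsum : ∀ n, ∑ j, m j * r n j = C * (h * (n + 1)) - m k * h := by
    intro n
    have : ∀ j, m j * r n j = m j * (h * (n + 1)) - if j = k then m k * h else 0 := by
      intro j
      rcases eq_or_ne j k with rfl | hj
      · rw [hrk, if_pos rfl]; ring
      · rw [hrj n j hj, if_neg hj, sub_zero]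
    simp_rw [this]
    rw [Finset.sum_sub_distrib, ← Finset.sum_mul, Finset.sum_ite_eq' Finset.univ k,
      if_pos (Finset.mem_univ k)]
  let V : ℕ → Set Ω := fun n => {ω | ∀ p, T p ω ∉ Set.Ioc 0 (r n p.1)}
  let W : ℕ → Set Ω := fun n => {ω | ∀ p, T p ω ∉ Set.Ioc 0 (h * (n + 1))}
  have hV : ∀ n, MeasurableSet (V n) := fun n => hT.measurableSet_void (r n)
  have hW : ∀ n, MeasurableSet (W n) := fun n => hT.measurableSet_void fun _ => h * (n + 1)
  have hWV : ∀ n, W n ⊆ V n := fun n ω hω p hp => hω p ⟨hp.1, hp.2.trans (hrle n _)⟩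
  have hD : ∀ n, μ (V n \ W n) = ENNReal.ofReal
      ((Real.exp (m k * h) - 1) * Real.exp (-(C * h)) * Real.exp (-(C * h)) ^ n) := by
    intro n
    have hVn : μ (V n) = _ := hT.measure_void (hr0 n)
    have hWn : μ (W n) = _ := hT.measure_void (r := fun _ => h * (n + 1)) fun _ => by positivity
    rw [measure_sdiff (hWV n) (hW n).nullMeasurableSet (measure_ne_top _ _), hVn, hWn,
      ← ENNReal.ofReal_sub _ (Real.exp_pos _).le, hrsum, ← Finset.sum_mul, ← hC]
    congr 1
    rw [← Real.exp_nat_mul, mul_assoc, ← Real.exp_add, sub_mul, one_mul, ← Real.exp_add]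
    congr 2 <;> ring
  have hdisj : Pairwise fun n n' => Disjoint (V n \ W n) (V n' \ W n') := by
    refine (pairwise_disjoint_on fun n => V n \ W n).2 fun n n' hnn' => ?_
    refine Set.disjoint_left.2 fun ω hω hω' => ?_
    have hex : ¬ ∀ p, T p ω ∉ Set.Ioc 0 (h * (n + 1)) := hω.2
    push Not at hex
    obtain ⟨p, hp⟩ := hex
    have hle : (n : ℝ) + 1 ≤ n' := by exact_mod_cast hnn'
    refine hω'.1 p ⟨hp.1, hp.2.trans ?_⟩
    rcases eq_or_ne p.1 k with hpk | hpk
    · rw [hpk, hrk]; gcongr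
    · rw [hrj n' p.1 hpk]; gcongr
  have hsub : (⋃ n, V n \ W n : Set Ω) ≤ᵐ[μ] {ω | ∃ i, ∀ p, T (k, i) ω ≤ T p ω} := by
    filter_upwards [hT.ae_finite_and_injective, hT.pos] with ω hω hpos hmem
    obtain ⟨n, hn⟩ := Set.mem_iUnion.1 hmem
    have hex : ¬ ∀ p, T p ω ∉ Set.Ioc 0 (h * (n + 1)) := hn.2
    push Not at hex
    obtain ⟨p, hp⟩ := hex
    obtain ⟨⟨j, i⟩, -, hmin⟩ := exists_forall_le_of_finite hω.1 ⟨p, Set.mem_univ p⟩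
    have hj : j = k := by
      by_contra hj
      refine hn.1 (j, i) ⟨hpos _, ?_⟩
      rw [hrj n j hj]
      exact (hmin p (Set.mem_univ p)).trans hp.2
    subst hj
    exact ⟨i, fun q => hmin q (Set.mem_univ q)⟩
  have hlt : Real.exp (-(C * h)) < 1 := Real.exp_lt_one_iff.2 (neg_lt_zero.2 (mul_pos hC0 hh))
  have hgeom := (hasSum_geometric_of_lt_one (Real.exp_pos (-(C * h))).le hlt).mul_left
    ((Real.exp (m k * h) - 1) * Real.exp (-(C * h)))
  have hm1 : m k * h ≤ Real.exp (m k * h) - 1 := by linarith [Real.add_one_le_exp (m k * h)]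
  have hm0 : 0 < m k * h := mul_pos (hT.rate_pos k) hh
  have hm2 : 0 ≤ Real.exp (m k * h) - 1 := hm0.le.trans hm1
  have hle := measure_mono_ae hsub
  rw [measure_iUnion hdisj fun n => (hV n).diff (hW n)] at hle
  simp_rw [hD] at hle
  rw [← ENNReal.ofReal_tsum_of_nonneg (fun n => by positivity) hgeom.summable, hgeom.tsum_eq,
    ← ofReal_measureReal, ENNReal.ofReal_le_ofReal_iff measureReal_nonneg] at hle
  refine le_trans ?_ hle
  have hd : 1 - Real.exp (-(C * h)) ≤ C * h := by linarith [Real.add_one_le_exp (-(C * h))]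
  calc m k / C * Real.exp (-(C * h)) = m k * h * Real.exp (-(C * h)) * (C * h)⁻¹ := by
        field_simp
    _ ≤ _ := by
        have := sub_pos.2 hlt
        gcongr

lemma le_measureReal_first (hT : IsPoissonFamily T m μ) (k : κ) :
    m k / (∑ j, m j) ≤ μ.real {ω | ∃ i, ∀ p, T (k, i) ω ≤ T p ω} := by
  have hlim : Filter.Tendsto (fun h : ℝ => m k / (∑ j, m j) * Real.exp (-((∑ j, m j) * h)))
      (nhdsWithin 0 (Set.Ioi 0)) (nhds (m k / ∑ j, m j)) := by
    have hc : Continuous fun h : ℝ => m k / (∑ j, m j) * Real.exp (-((∑ j, m j) * h)) := by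
      fun_prop
    simpa using (hc.tendsto 0).mono_left nhdsWithin_le_nhds
  exact le_of_tendsto hlim (eventually_nhdsWithin_of_forall fun h hh =>
    hT.le_measureReal_first_of_step k hh)

/-- The overall first point belongs to the `k`-th family with probability proportional to the
intensity of that family. -/
lemma measureReal_first (hT : IsPoissonFamily T m μ) (k : κ) :
    μ.real {ω | ∃ i, ∀ p, T (k, i) ω ≤ T p ω} = m k / ∑ j, m j := by
  let E : κ → Set Ω := fun k => {ω | ∃ i, ∀ p, T (k, i) ω ≤ T p ω}
  have hE : ∀ k, MeasurableSet (E k) := hT.measurableSet_first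
  have hdisj : Pairwise fun j l => AEDisjoint μ (E j) (E l) := by
    intro j l hjl
    refine measure_eq_zero_iff_ae_notMem.2 ?_
    filter_upwards [hT.ae_finite_and_injective] with ω hω hmem
    obtain ⟨⟨i, hi⟩, ⟨i', hi'⟩⟩ := hmem
    have : (j, i) = (l, i') := hω.2 (le_antisymm (hi _) (hi' _))
    exact hjl (congrArg Prod.fst this)
  have hsum : ∑ j, μ.real (E j) ≤ 1 := by
    have h1 : ∑ j, μ (E j) ≤ 1 := by
      rw [← tsum_fintype (L := .unconditional _), ← measure_iUnion₀ hdisj fun j =>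
        (hE j).nullMeasurableSet]
      exact prob_le_one
    have h2 := ENNReal.toReal_mono ENNReal.one_ne_top h1
    rwa [ENNReal.toReal_sum fun j _ => measure_ne_top _ _, ENNReal.toReal_one] at h2
  have hC0 : 0 < ∑ j, m j := Finset.sum_pos (fun j _ => hT.rate_pos j) ⟨k, Finset.mem_univ k⟩
  have hone : ∑ j, m j / ∑ l, m l = 1 := by
    rw [← Finset.sum_div, div_self hC0.ne']
  -- The lower bounds sum to one, and the almost disjoint events have total probability at most one,
  -- so every bound is an equality.
  have heq := (Finset.sum_eq_sum_iff_of_le fun j (_ : j ∈ Finset.univ) =>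
    hT.le_measureReal_first j).1 (le_antisymm
      (Finset.sum_le_sum fun j _ => hT.le_measureReal_first j) (hsum.trans hone.ge))
  exact (heq k (Finset.mem_univ k)).symm

end IsPoissonFamily

/-! ### Cell selection as a minimum of path losses -/

section Selection

variable {Ω : Type*} {K : ℕ} {α : ℝ} {P B : Fin K → ℝ} {X : Fin K → ℕ → Ω → Plane}
  {χ : Fin K → ℕ → Ω → ℝ} {ω : Ω} {t : Fin K × ℕ → ℝ}

lemma isCandidate_iff (hB : ∀ k, 0 < B k)
    (ht : ∀ p q, t p ≤ t q ↔ B q.1 * longTermPower α P X χ q.1 q.2 ω ≤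
      B p.1 * longTermPower α P X χ p.1 p.2 ω) (k : Fin K) (i : ℕ) :
    IsCandidate α P X χ k i ω ↔ ∀ i', t (k, i) ≤ t (k, i') := by
  refine forall_congr' fun i' => ?_
  rw [ht, mul_le_mul_iff_right₀ (hB k)]

lemma exists_isCandidate (hB : ∀ k, 0 < B k)
    (ht : ∀ p q, t p ≤ t q ↔ B q.1 * longTermPower α P X χ q.1 q.2 ω ≤
      B p.1 * longTermPower α P X χ p.1 p.2 ω) (hfin : ∀ r, {p | t p ≤ r}.Finite) (k : Fin K) :
    ∃ i, IsCandidate α P X χ k i ω := by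
  obtain ⟨p, ⟨i, rfl⟩, hi⟩ := exists_forall_le_of_finite hfin
    (Set.range_nonempty fun i : ℕ => ((k, i) : Fin K × ℕ))
  exact ⟨i, (isCandidate_iff hB ht k i).2 fun i' => hi _ ⟨i', rfl⟩⟩

/-- Beating the candidates means beating all stations: finiteness of sublevel sets gives each tier a
candidate, which dominates its tier. -/
lemma isServing_iff (hB : ∀ k, 0 < B k)
    (ht : ∀ p q, t p ≤ t q ↔ B q.1 * longTermPower α P X χ q.1 q.2 ω ≤
      B p.1 * longTermPower α P X χ p.1 p.2 ω) (hfin : ∀ r, {p | t p ≤ r}.Finite)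
    (k : Fin K) (i : ℕ) :
    IsServing α P B X χ k i ω ↔ ∀ p, t (k, i) ≤ t p := by
  constructor
  · rintro ⟨-, hmax⟩ ⟨k', i'⟩
    obtain ⟨j, hj⟩ := exists_isCandidate hB ht hfin k'
    exact ((ht (k, i) (k', j)).2 (hmax k' j hj)).trans ((isCandidate_iff hB ht k' j).1 hj i')
  · intro h
    exact ⟨(isCandidate_iff hB ht k i).2 fun i' => h _, fun k' i' _ => (ht _ (k', i')).1 (h _)⟩

lemma existsUnique_isCandidate (hB : ∀ k, 0 < B k)
    (ht : ∀ p q, t p ≤ t q ↔ B q.1 * longTermPower α P X χ q.1 q.2 ω ≤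
      B p.1 * longTermPower α P X χ p.1 p.2 ω) (hfin : ∀ r, {p | t p ≤ r}.Finite)
    (hinj : Function.Injective t) (k : Fin K) : ∃! i, IsCandidate α P X χ k i ω := by
  obtain ⟨i, hi⟩ := exists_isCandidate hB ht hfin k
  refine ⟨i, hi, fun j hj => ?_⟩
  rw [isCandidate_iff hB ht] at hi hj
  exact congrArg Prod.snd (hinj (le_antisymm (hj i) (hi j)))

lemma existsUnique_isServing [Nonempty (Fin K)] (hB : ∀ k, 0 < B k)
    (ht : ∀ p q, t p ≤ t q ↔ B q.1 * longTermPower α P X χ q.1 q.2 ω ≤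
      B p.1 * longTermPower α P X χ p.1 p.2 ω) (hfin : ∀ r, {p | t p ≤ r}.Finite)
    (hinj : Function.Injective t) : ∃! p : Fin K × ℕ, IsServing α P B X χ p.1 p.2 ω := by
  obtain ⟨p, -, hp⟩ := exists_forall_le_of_finite hfin Set.univ_nonempty
  refine ⟨p, (isServing_iff hB ht hfin p.1 p.2).2 fun q => hp q (Set.mem_univ q), fun q hq => ?_⟩
  exact hinj (le_antisymm ((isServing_iff hB ht hfin q.1 q.2).1 hq p) (hp q (Set.mem_univ q)))

end Selection

/-! ### The network as a Poisson family -/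

section PathLoss

variable {Ω : Type*} [MeasurableSpace Ω] {μ : Measure Ω} [IsProbabilityMeasure μ]

/-- A singleton has area zero, so its count is Poisson of mean zero. The origin must be excluded
because `‖0‖ ^ (-α)` is `0` by convention, not infinite. -/
lemma IsHomogeneousPPP.ae_ne_zero {X : ℕ → Ω → Plane} {dens : ℝ}
    (hX : IsHomogeneousPPP X dens μ) : ∀ᵐ ω ∂μ, ∀ i, X i ω ≠ 0 := by
  have h := hX.count_law 1 (fun _ => {0}) (fun _ => 0) (fun _ => measurableSet_singleton 0)
    (fun _ => Bornology.isBounded_singleton) fun i j hij => absurd (Subsingleton.elim i j) hij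
  have hm : MeasurableSet {ω | ∀ _ : Fin 1, pointCount X {0} ω = ((0 : ℕ) : ℕ∞)} := by
    rw [Set.ofPred_forall]
    exact .iInter fun _ => measurable_pointCount hX.measurable (measurableSet_singleton 0)
      (.of_discrete (s := {_}))
  have h1 : μ {ω | ∀ _ : Fin 1, pointCount X {0} ω = ((0 : ℕ) : ℕ∞)} = 1 := by
    rw [← ofReal_measureReal, h]
    simp [measureReal_def]
  filter_upwards [(prob_compl_eq_zero_iff hm).2 h1 |> measure_eq_zero_iff_ae_notMem.1] with ω hω i hi
  have : pointCount X {0} ω = 0 := by simpa using hω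
  rw [pointCount, Set.encard_eq_zero] at this
  exact (Set.ext_iff.1 this i).1 hi

lemma integral_rpow_pos {ν : Measure ℝ} [IsProbabilityMeasure ν] (hνpos : ∀ᵐ t ∂ν, 0 < t) {s : ℝ}
    (hν : Integrable (fun t : ℝ => t ^ s) ν) : 0 < ∫ t, t ^ s ∂ν := by
  have hpos : ∀ᵐ t ∂ν, 0 < t ^ s := hνpos.mono fun t ht => Real.rpow_pos_of_pos ht s
  rw [integral_pos_iff_support_of_nonneg_ae (hpos.mono fun t ht => ht.le) hν]
  have : Function.support (fun t : ℝ => t ^ s) =ᵐ[ν] Set.univ := by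
    filter_upwards [hpos] with t ht
    exact propext ⟨fun _ => trivial, fun _ => ht.ne'⟩
  rw [measure_congr this, measure_univ]
  exact one_pos

/-- The path losses of all base stations of a heterogeneous network with shadowing. -/
lemma isPoissonFamily_pathLoss {K : ℕ} {α : ℝ} (hα : 0 < α) {dens b : Fin K → ℝ}
    (hdens : ∀ k, 0 < dens k) (hb : ∀ k, 0 < b k) {X : Fin K → ℕ → Ω → Plane}
    (hX : ∀ k, IsHomogeneousPPP (X k) (dens k) μ)
    (hXindep : iIndepFun (fun k => countingProcess (X k)) μ)
    {ν : Fin K → Measure ℝ} (hνpos : ∀ k, ∀ᵐ t ∂(ν k), 0 < t)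
    (hνmoment : ∀ k, Integrable (fun t : ℝ => t ^ (2 / α)) (ν k))
    {χ : Fin K → ℕ → Ω → ℝ} (hχ : ∀ k i, Measurable (χ k i))
    (hχlaw : ∀ k i, μ.map (χ k i) = ν k)
    (hχindep : iIndepFun (fun p : Fin K × ℕ => χ p.1 p.2) μ)
    (hχX : IndepFun (fun ω (p : Fin K × ℕ) => χ p.1 p.2 ω)
      (fun ω (p : Fin K × ℕ) => X p.1 p.2 ω) μ)
    (hpos : ∀ᵐ ω ∂μ, ∀ k i, X k i ω ≠ 0 ∧ 0 < χ k i ω) :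
    IsPoissonFamily (fun (p : Fin K × ℕ) ω => pathLoss α (b p.1) (X p.1 p.2 ω, χ p.1 p.2 ω))
      (fun k => dens k * (Real.pi * b k ^ (2 / α) * ∫ t, t ^ (2 / α) ∂(ν k))) μ := by
  have hν : ∀ k, IsProbabilityMeasure (ν k) := fun k => by
    rw [← hχlaw k 0]
    exact Measure.isProbabilityMeasure_map (hχ k 0).aemeasurable
  have hM : ∀ k, 0 < ∫ t, t ^ (2 / α) ∂(ν k) := fun k => integral_rpow_pos (hνpos k) (hνmoment k)
  have hrate : ∀ k, 0 < dens k * (Real.pi * b k ^ (2 / α) * ∫ t, t ^ (2 / α) ∂(ν k)) := fun k =>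
    mul_pos (hdens k) (mul_pos (mul_pos Real.pi_pos (Real.rpow_pos_of_pos (hb k) _)) (hM k))
  refine ⟨fun p => ?_, ?_, hrate, fun θ a c ha hac => ?_⟩
  · exact (measurable_pathLoss _ _).comp (((hX p.1).measurable p.2).prodMk (hχ p.1 p.2))
  · filter_upwards [hpos] with ω hω p
    have hx := norm_pos_iff.2 (hω p.1 p.2).1
    have hb := hb p.1
    have ht := (hω p.1 p.2).2
    exact Real.rpow_pos_of_pos (by positivity) _
  · have hmeas : ∀ k, Measurable fun z : Plane × ℝ =>
        θ * (Set.Ioc (a k) (c k)).indicator (1 : ℝ → ℝ≥0∞) (pathLoss α (b k) z) := fun k =>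
      ((measurable_one.indicator measurableSet_Ioc).comp (measurable_pathLoss α (b k))).const_mul θ
    rw [lintegral_expNeg_tsum_marked (fun k => (hdens k).le) hX hXindep hχ hχlaw hχindep hχX hmeas,
      ENNReal.ofReal_sum_of_nonneg fun k _ => mul_nonneg (hrate k).le (sub_nonneg.2 (hac k)),
      Finset.sum_mul]
    congr 1
    refine Finset.sum_congr rfl fun k _ => ?_
    rw [lintegral_pathLoss_Ioc hα (hb k) (ha k) (hac k) (hνpos k) (hνmoment k), ← mul_assoc,
      ← ENNReal.ofReal_mul (hdens k).le, mul_assoc (dens k)]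

end PathLoss

theorem lemma2 {Ω : Type*} [MeasurableSpace Ω] (μ : Measure Ω) [IsProbabilityMeasure μ]
    (K : ℕ) (hK : 0 < K) (α : ℝ) (hα : 0 < α)
    (dens P B : Fin K → ℝ) (hdens : ∀ k, 0 < dens k) (hP : ∀ k, 0 < P k) (hB : ∀ k, 0 < B k)
    -- the base stations of the tiers: independent Poisson point processes
    (X : Fin K → ℕ → Ω → Plane)
    (hX : ∀ k, IsHomogeneousPPP (X k) (dens k) μ)
    (hXindep : iIndepFun (fun k => countingProcess (X k)) μ)
    -- the shadowing gains: positive, with an arbitrary distribution `ν k` in tier `k` whose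
    -- moment of order `2 / α` is finite, independent of each other and of all locations
    (ν : Fin K → Measure ℝ) (hνpos : ∀ k, ∀ᵐ t ∂(ν k), 0 < t)
    (hνmoment : ∀ k, Integrable (fun t : ℝ => t ^ (2 / α)) (ν k))
    (χ : Fin K → ℕ → Ω → ℝ) (hχ : ∀ k i, Measurable (χ k i))
    (hχlaw : ∀ k i, μ.map (χ k i) = ν k)
    (hχindep : iIndepFun (fun p : Fin K × ℕ => χ p.1 p.2) μ)
    (hχX : IndepFun (fun ω (p : Fin K × ℕ) => χ p.1 p.2 ω)
      (fun ω (p : Fin K × ℕ) => X p.1 p.2 ω) μ) :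
    -- almost surely the candidate of every tier and the serving base station are well defined
    (∀ᵐ ω ∂μ, (∀ k, ∃! i, IsCandidate α P X χ k i ω) ∧
      ∃! p : Fin K × ℕ, IsServing α P B X χ p.1 p.2 ω) ∧
    -- the selection probabilities
    ∀ k, μ.real {ω | selectionIndicator α P B X χ k ω = 1} =
      dens k * (∫ t, t ^ (2 / α) ∂(ν k)) * B k ^ (2 / α) * P k ^ (2 / α) /
        ∑ j, dens j * (∫ t, t ^ (2 / α) ∂(ν j)) * B j ^ (2 / α) * P j ^ (2 / α) := by
  have : Nonempty (Fin K) := ⟨⟨0, hK⟩⟩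
  have hb : ∀ k, 0 < B k * P k := fun k => mul_pos (hB k) (hP k)
  have hpos : ∀ᵐ ω ∂μ, ∀ k i, X k i ω ≠ 0 ∧ 0 < χ k i ω := by
    refine ae_all_iff.2 fun k => ?_
    have hχpos : ∀ᵐ ω ∂μ, ∀ i, 0 < χ k i ω := ae_all_iff.2 fun i =>
      ae_of_ae_map (hχ k i).aemeasurable ((hχlaw k i).symm ▸ hνpos k)
    filter_upwards [(hX k).ae_ne_zero, hχpos] with ω h₁ h₂ i
    exact ⟨h₁ i, h₂ i⟩
  have hT := isPoissonFamily_pathLoss hα hdens hb hX hXindep hνpos hνmoment hχ hχlaw hχindep hχX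
    hpos
  have hle : ∀ᵐ ω ∂μ, ∀ p q : Fin K × ℕ,
      pathLoss α (B p.1 * P p.1) (X p.1 p.2 ω, χ p.1 p.2 ω) ≤
        pathLoss α (B q.1 * P q.1) (X q.1 q.2 ω, χ q.1 q.2 ω) ↔
      B q.1 * longTermPower α P X χ q.1 q.2 ω ≤ B p.1 * longTermPower α P X χ p.1 p.2 ω := by
    filter_upwards [hpos] with ω hω p q
    have hY : ∀ p : Fin K × ℕ, 0 < B p.1 * longTermPower α P X χ p.1 p.2 ω ∧
        pathLoss α (B p.1 * P p.1) (X p.1 p.2 ω, χ p.1 p.2 ω) =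
          (B p.1 * longTermPower α P X χ p.1 p.2 ω) ^ (-(2 / α)) := by
      intro p
      have hx := norm_pos_iff.2 (hω p.1 p.2).1
      have ht := (hω p.1 p.2).2
      have hB := hB p.1
      have hP := hP p.1
      refine ⟨?_, ?_⟩
      · unfold longTermPower
        positivity
      · rw [pathLoss, longTermPower]
        congr 1
        ring
    rw [(hY p).2, (hY q).2]
    exact Real.rpow_le_rpow_iff_of_neg (hY p).1 (hY q).1 (neg_lt_zero.2 (by positivity))
  refine ⟨?_, fun k => ?_⟩
  · filter_upwards [hle, hT.ae_finite_and_injective] with ω ht hω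
    exact ⟨existsUnique_isCandidate hB ht hω.1 hω.2, existsUnique_isServing hB ht hω.1 hω.2⟩
  · have hset : {ω | selectionIndicator α P B X χ k ω = 1} =ᵐ[μ]
        {ω | ∃ i, ∀ p : Fin K × ℕ, pathLoss α (B k * P k) (X k i ω, χ k i ω) ≤
          pathLoss α (B p.1 * P p.1) (X p.1 p.2 ω, χ p.1 p.2 ω)} := by
      filter_upwards [hle, hT.ae_finite_and_injective] with ω ht hω
      refine propext ?_
      change selectionIndicator α P B X χ k ω = 1 ↔ _
      simp only [selectionIndicator, ite_eq_left_iff, zero_ne_one, imp_false, not_not]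
      exact exists_congr fun i => isServing_iff hB ht hω.1 k i
    rw [measureReal_congr hset, hT.measureReal_first k]
    have hrate : ∀ j, dens j * (Real.pi * (B j * P j) ^ (2 / α) * ∫ t, t ^ (2 / α) ∂(ν j)) =
        Real.pi * (dens j * (∫ t, t ^ (2 / α) ∂(ν j)) * B j ^ (2 / α) * P j ^ (2 / α)) := by
      intro j
      rw [Real.mul_rpow (hB j).le (hP j).le]
      ring
    simp_rw [hrate]
    rw [← Finset.mul_sum, mul_div_mul_left _ _ Real.pi_ne_zero]
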